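/- Let $n\ge 2$ and let $k_1,\dots,k_n$ be positive integers, where the case $n=2$, $k_1=k_2=1$ is excluded. Let $S(k_1,\dots,k_n)$ be the graph obtained from the star $K_{1,n}$ with root $v_1$ by inserting $k_j-1$ new vertices into its $j$-th edge, for each $j$, so that this edge becomes a path with $k_j+1$ vertices (root included). Let $\Gamma$ be the infinite graph obtained from the disjoint union of $S(k_1,\dots,k_n)$ and the one-sided infinite path by joining the root $v_1$ to the end vertex of the path by a new edge. Let $A$ be the adjacency operator of $\Gamma$, that is, the bounded self-adjoint operator on the complex Hilbert space $\ell^2(\mathcal V(\Gamma))$ given by $(Af)(v)=\sum_{w\sim v}f(w)$. Then the equation $$\sum_{j=1}^n\frac{\sinh(k_jt)}{\sinh((k_j+1)t)}=e^t \qquad (*)$$ has exactly one solution $t_+$ in $(0,\infty)$, and the discrete spectrum $\sigma_d(\Gamma)$, i.e. the set of eigenvalues of $A$ of finite multiplicity that lie outside $[-2,2]$, coincides with the part of the spectrum outside $[-2,2]$ and equals $$\sigma_d(\Gamma)=\sigma(A)\setminus[-2,2]=\{2\cosh t_+,\,-2\cosh t_+\}.$$ Moreover, if $k_1=\dots=k_n=p$,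 then a number $t>0$ satisfies $(*)$ if and only if $x=e^{-t}$ satisfies $$(n-1)x^{2p+2}-nx^2+1=0.$$ -/

import Mathlib

open scoped ENNReal

noncomputable section

namespace TailedGraph

variable {V W : Type*}

/-- The vertex degrees are finite and uniformly bounded. -/
def UniformlyLocallyFinite (G : SimpleGraph V) : Prop :=
  ∃ d : ℕ, ∀ v, (G.neighborSet v).encard ≤ d

theorem UniformlyLocallyFinite.finite {G : SimpleGraph V} (h : UniformlyLocallyFinite G) (v : V) :
    (G.neighborSet v).Finite := by
  obtain ⟨d, hd⟩ := h
  exact Set.finite_of_encard_le_coe (hd v)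

/-- The finite set of neighbours of `v`. -/
def UniformlyLocallyFinite.nbrs {G : SimpleGraph V} (h : UniformlyLocallyFinite G) (v : V) :
    Finset V :=
  (h.finite v).toFinset

theorem UniformlyLocallyFinite.mem_nbrs {G : SimpleGraph V} (h : UniformlyLocallyFinite G)
    {v w : V} : w ∈ h.nbrs v ↔ G.Adj v w := by
  simp [UniformlyLocallyFinite.nbrs]

theorem UniformlyLocallyFinite.exists_card_le {G : SimpleGraph V}
    (h : UniformlyLocallyFinite G) : ∃ d : ℕ, ∀ v, (h.nbrs v).card ≤ d := by
  obtain ⟨d, hd⟩ := id h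
  refine ⟨d, fun v => ?_⟩
  have := hd v
  rw [(h.finite v).encard_eq_coe_toFinset_card] at this
  exact_mod_cast this

theorem sum_sq_le {G : SimpleGraph V} (h : UniformlyLocallyFinite G) {d : ℕ}
    (hd : ∀ v, (h.nbrs v).card ≤ d) (f : lp (fun _ : V => ℂ) 2) (s : Finset V) :
    ∑ v ∈ s, ‖∑ w ∈ h.nbrs v, f w‖ ^ (2 : ℝ≥0∞).toReal
      ≤ ((d : ℝ) * ‖f‖) ^ (2 : ℝ≥0∞).toReal := by
  classical
  have key : ∀ u : Finset V, ∑ w ∈ u, ‖f w‖ ^ 2 ≤ ‖f‖ ^ 2 := by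
    intro u
    have := lp.sum_rpow_le_norm_rpow (p := 2) (by norm_num) f u
    simpa using this
  have h1 : ∀ v ∈ s, ‖∑ w ∈ h.nbrs v, f w‖ ^ 2
      ≤ (d : ℝ) * ∑ w ∈ s.biUnion h.nbrs, if w ∈ h.nbrs v then ‖f w‖ ^ 2 else 0 := by
    intro v hv
    have e : (∑ w ∈ s.biUnion h.nbrs, if w ∈ h.nbrs v then ‖f w‖ ^ 2 else 0)
        = ∑ w ∈ h.nbrs v, ‖f w‖ ^ 2 := by
      rw [← Finset.sum_filter]
      congr 1
      ext w
      simp only [Finset.mem_filter, Finset.mem_biUnion]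
      exact ⟨fun hw => hw.2, fun hw => ⟨⟨v, hv, hw⟩, hw⟩⟩
    rw [e]
    calc ‖∑ w ∈ h.nbrs v, f w‖ ^ 2 ≤ (∑ w ∈ h.nbrs v, ‖f w‖) ^ 2 := by
          gcongr
          exact norm_sum_le _ _
      _ ≤ ((h.nbrs v).card : ℝ) * ∑ w ∈ h.nbrs v, ‖f w‖ ^ 2 := sq_sum_le_card_mul_sum_sq
      _ ≤ (d : ℝ) * ∑ w ∈ h.nbrs v, ‖f w‖ ^ 2 := by
          gcongr
          exact_mod_cast hd v
  have h2 : ∀ w, (∑ v ∈ s, if w ∈ h.nbrs v then ‖f w‖ ^ 2 else 0) ≤ (d : ℝ) * ‖f w‖ ^ 2 := by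
    intro w
    rw [← Finset.sum_filter, Finset.sum_const, nsmul_eq_mul]
    have hc : (s.filter fun v => w ∈ h.nbrs v).card ≤ d := by
      refine le_trans (Finset.card_le_card ?_) (hd w)
      intro v hv
      exact h.mem_nbrs.2 (h.mem_nbrs.1 (Finset.mem_filter.1 hv).2).symm
    gcongr
  have : ∑ v ∈ s, ‖∑ w ∈ h.nbrs v, f w‖ ^ 2 ≤ ((d : ℝ) * ‖f‖) ^ 2 := by
    calc ∑ v ∈ s, ‖∑ w ∈ h.nbrs v, f w‖ ^ 2
        ≤ ∑ v ∈ s, (d : ℝ) * ∑ w ∈ s.biUnion h.nbrs,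
            if w ∈ h.nbrs v then ‖f w‖ ^ 2 else 0 := Finset.sum_le_sum h1
      _ = (d : ℝ) * ∑ w ∈ s.biUnion h.nbrs, ∑ v ∈ s,
            if w ∈ h.nbrs v then ‖f w‖ ^ 2 else 0 := by
          rw [← Finset.mul_sum, Finset.sum_comm]
      _ ≤ (d : ℝ) * ∑ w ∈ s.biUnion h.nbrs, (d : ℝ) * ‖f w‖ ^ 2 := by
          gcongr with w hw
          exact h2 w
      _ = (d : ℝ) * ((d : ℝ) * ∑ w ∈ s.biUnion h.nbrs, ‖f w‖ ^ 2) := by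
          rw [← Finset.mul_sum]
      _ ≤ (d : ℝ) * ((d : ℝ) * ‖f‖ ^ 2) := by
          gcongr
          exact key _
      _ = ((d : ℝ) * ‖f‖) ^ 2 := by ring
  simpa using this

/-- The adjacency operator of a uniformly locally finite graph `G` as a linear map on `ℓ²(V)`:
`(A f)(v)` is the sum of `f w` over the neighbours `w` of `v`. -/
def adjacencyLinearMap (G : SimpleGraph V) (h : UniformlyLocallyFinite G) :
    lp (fun _ : V => ℂ) 2 →ₗ[ℂ] lp (fun _ : V => ℂ) 2 where
  toFun f := ⟨fun v => ∑ w ∈ h.nbrs v, f w, by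
    obtain ⟨d, hd⟩ := h.exists_card_le
    exact memℓp_gen' (sum_sq_le h hd f)⟩
  map_add' f g := by
    ext v
    exact Finset.sum_add_distrib
  map_smul' c f := by
    ext v
    simp [Finset.mul_sum]

/-- The adjacency operator of a uniformly locally finite graph, a bounded operator on `ℓ²(V)`. -/
def adjacencyOperator (G : SimpleGraph V) (h : UniformlyLocallyFinite G) :
    lp (fun _ : V => ℂ) 2 →L[ℂ] lp (fun _ : V => ℂ) 2 where
  toLinearMap := adjacencyLinearMap G h
  cont := by
    obtain ⟨d, hd⟩ := h.exists_card_le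
    refine AddMonoidHomClass.continuous_of_bound (adjacencyLinearMap G h) d fun f => ?_
    exact lp.norm_le_of_forall_sum_le (by norm_num) (by positivity) (sum_sq_le h hd f)

theorem adjacencyOperator_apply (G : SimpleGraph V) (h : UniformlyLocallyFinite G)
    (f : lp (fun _ : V => ℂ) 2) (v : V) :
    adjacencyOperator G h f v = ∑ w ∈ h.nbrs v, f w := rfl

/-- The coupling of two graphs by the bridge `{v, w}`: their disjoint union together with
the edge from `v` to `w`. -/
def coupling (G : SimpleGraph V) (H : SimpleGraph W) (v : V) (w : W) : SimpleGraph (V ⊕ W) :=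
  SimpleGraph.sum G H ⊔ SimpleGraph.edge (Sum.inl v) (Sum.inr w)

/-- The one-sided infinite path `0 - 1 - 2 - ⋯`. -/
def ray : SimpleGraph ℕ :=
  SimpleGraph.hasse ℕ

/-- The star with `n` edges whose `j`-th edge is subdivided so as to contain `k j + 1` vertices.
The root is `none`, and `some ⟨j, i⟩` is the vertex of the `j`-th edge at distance `i + 1` from
the root. -/
def multipleStar {n : ℕ} (k : Fin n → ℕ) : SimpleGraph (Option (Σ j : Fin n, Fin (k j))) :=
  SimpleGraph.fromRel fun a b =>
    (∃ (j : Fin n) (i : Fin (k j)), a = none ∧ b = some ⟨j, i⟩ ∧ i.val = 0) ∨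
    (∃ (j : Fin n) (i i' : Fin (k j)),
      a = some ⟨j, i⟩ ∧ b = some ⟨j, i'⟩ ∧ i'.val = i.val + 1)

/-- The multiple star with the infinite path attached to its root. -/
def multipleStarRay {n : ℕ} (k : Fin n → ℕ) :
    SimpleGraph (Option (Σ j : Fin n, Fin (k j)) ⊕ ℕ) :=
  coupling (multipleStar k) ray none 0

theorem uniformlyLocallyFinite_ray : UniformlyLocallyFinite ray := by
  refine ⟨2, fun v => ?_⟩
  have : ray.neighborSet v ⊆ {v - 1, v + 1} := by
    intro w hw
    simp only [ray, SimpleGraph.mem_neighborSet, SimpleGraph.hasse_adj,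
      Nat.covBy_iff_add_one_eq] at hw
    simp only [Set.mem_insert_iff, Set.mem_singleton_iff]
    omega
  refine (Set.encard_le_encard this).trans ((Set.encard_insert_le _ _).trans ?_)
  rw [Set.encard_singleton]
  norm_num

theorem uniformlyLocallyFinite_of_finite [Finite V] (G : SimpleGraph V) :
    UniformlyLocallyFinite G := by
  refine ⟨Nat.card V, fun v => ?_⟩
  refine (Set.encard_le_encard (Set.subset_univ _)).trans ?_
  rw [Set.encard_univ, ENat.card_eq_coe_natCard]

theorem uniformlyLocallyFinite_coupling {G : SimpleGraph V} {H : SimpleGraph W}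
    (hG : UniformlyLocallyFinite G) (hH : UniformlyLocallyFinite H) (v : V) (w : W) :
    UniformlyLocallyFinite (coupling G H v w) := by
  obtain ⟨d, hd⟩ := hG
  obtain ⟨e, he⟩ := hH
  refine ⟨d + e + 1, fun x => ?_⟩
  rcases x with a | b
  · have : (coupling G H v w).neighborSet (Sum.inl a)
        ⊆ Sum.inl '' G.neighborSet a ∪ {Sum.inr w} := by
      rintro (y | y) hy <;> simp_all [coupling, SimpleGraph.edge_adj]
    calc _ ≤ _ := Set.encard_le_encard this
      _ ≤ _ := Set.encard_union_le _ _
      _ ≤ (d : ℕ∞) + 1 := by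
        gcongr
        · exact (Set.encard_image_le _ _).trans (hd a)
        · simp
      _ ≤ _ := by norm_cast; omega
  · have : (coupling G H v w).neighborSet (Sum.inr b)
        ⊆ Sum.inr '' H.neighborSet b ∪ {Sum.inl v} := by
      rintro (y | y) hy <;> simp_all [coupling, SimpleGraph.edge_adj]
    calc _ ≤ _ := Set.encard_le_encard this
      _ ≤ _ := Set.encard_union_le _ _
      _ ≤ (e : ℕ∞) + 1 := by
        gcongr
        · exact (Set.encard_image_le _ _).trans (he b)
        · simp
      _ ≤ _ := by norm_cast; omega

theorem uniformlyLocallyFinite_multipleStarRay {n : ℕ} (k : Fin n → ℕ) :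
    UniformlyLocallyFinite (multipleStarRay k) :=
  uniformlyLocallyFinite_coupling (uniformlyLocallyFinite_of_finite _)
    uniformlyLocallyFinite_ray _ _

/-- The adjacency operator of the multiple star with the infinite path attached to its root. -/
def multipleStarRayOperator {n : ℕ} (k : Fin n → ℕ) :
    lp (fun _ : Option (Σ j : Fin n, Fin (k j)) ⊕ ℕ => ℂ) 2 →L[ℂ]
      lp (fun _ : Option (Σ j : Fin n, Fin (k j)) ⊕ ℕ => ℂ) 2 :=
  adjacencyOperator (multipleStarRay k) (uniformlyLocallyFinite_multipleStarRay k)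

/-- The interval `[-2, 2]` as a subset of `ℂ`. -/
def band : Set ℂ :=
  Complex.ofReal '' Set.Icc (-2 : ℝ) 2

/-- The discrete spectrum of a finite graph with a tail: the eigenvalues of finite multiplicity
off `[-2, 2]`. -/
def discreteSpectrum {E : Type*} [NormedAddCommGroup E] [NormedSpace ℂ E] (A : E →L[ℂ] E) :
    Set ℂ :=
  {z | z ∉ band ∧ Module.End.HasEigenvalue (A : Module.End ℂ E) z ∧
    FiniteDimensional ℂ (Module.End.eigenspace (A : Module.End ℂ E) z)}

/-- The equation `∑ⱼ sinh (kⱼ t) / sinh ((kⱼ + 1) t) = exp t`. -/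
def StarEquation {n : ℕ} (k : Fin n → ℕ) (t : ℝ) : Prop :=
  ∑ j, Real.sinh ((k j : ℝ) * t) / Real.sinh (((k j : ℝ) + 1) * t) = Real.exp t

end TailedGraph

end

noncomputable section

namespace TailedGraph

variable {V : Type*}

/-! ### Adjacency operators, eigenvalues under compact perturbation -/

section General

/-! Self-adjointness makes the spectrum real, so a spectral value `z` off the band has `2 < |z|`.
Deleting the star edges and the bridge leaves isolated vertices and a ray, whose operator has norm
at most 2, and changes only finitely many coordinates of each image. The Fredholm alternative then
makes `z` an eigenvalue.

Write `z = 2 ε cosh t = x + x⁻¹` with `ε = ±1`, `t > 0` and `x = ε exp (-t)`. On the tail an ℓ²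
eigenvector must be a multiple of `x ^ m`; on each leg it is a multiple of `ε ^ m sinh (m t)`
counted back from just past the leaf. The root value thus fixes the vector, and the equation at the
root reads `ε exp (-t) + ε ∑ sinh (kⱼ t) / sinh ((kⱼ + 1) t) = 2 ε cosh t`. Here `ε` cancels and the
star equation remains, so eigenvalues occur in pairs `±2 cosh t`.

For uniqueness, each quotient is a finite continued fraction, nonincreasing in `t`, while `exp t`
increases strictly. At `t = 0` the sum extends to `∑ kⱼ / (kⱼ + 1)`, which exceeds 1 by the
exclusion of `n = 2`, `k = (1, 1)`. -/

theorem adjacencyOperator_single [DecidableEq V] (G : SimpleGraph V)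
    (h : UniformlyLocallyFinite G) (v : V) :
    adjacencyOperator G h (lp.single 2 v 1) = ∑ w ∈ h.nbrs v, lp.single 2 w (1 : ℂ) := by
  ext u
  rw [adjacencyOperator_apply, lp.coeFn_sum, Finset.sum_apply]
  simp only [lp.single_apply, Pi.single_apply, Finset.sum_ite_eq, Finset.sum_ite_eq']
  exact if_congr (by rw [h.mem_nbrs, h.mem_nbrs, G.adj_comm]) rfl rfl

/-- The adjacency operator of a uniformly locally finite graph is self-adjoint. -/
theorem isSelfAdjoint_adjacencyOperator (G : SimpleGraph V) (h : UniformlyLocallyFinite G) :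
    IsSelfAdjoint (adjacencyOperator G h) := by
  classical
  rw [ContinuousLinearMap.isSelfAdjoint_iff']
  ext f v
  have e : ∀ (g : lp (fun _ : V => ℂ) 2) (w : V), g w = inner ℂ (lp.single 2 w (1 : ℂ)) g := by
    intro g w
    rw [lp.inner_single_left]
    simp
  rw [e, ContinuousLinearMap.adjoint_inner_right, adjacencyOperator_single, sum_inner,
    adjacencyOperator_apply]
  exact Finset.sum_congr rfl fun w _ => (e f w).symm

theorem norm_adjacencyOperator_le (G : SimpleGraph V) (h : UniformlyLocallyFinite G) {d : ℕ}
    (hd : ∀ v, (h.nbrs v).card ≤ d) : ‖adjacencyOperator G h‖ ≤ d :=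
  ContinuousLinearMap.opNorm_le_bound _ (by positivity) fun f =>
    lp.norm_le_of_forall_sum_le (by norm_num) (by positivity) (sum_sq_le h hd f)

/-- A spectral value of a compact perturbation that is not a spectral value of the unperturbed
operator is an eigenvalue. -/
theorem hasEigenvalue_of_mem_spectrum_add {E : Type*} [NormedAddCommGroup E] [NormedSpace ℂ E]
    [CompleteSpace E] {B K : E →L[ℂ] E} (hK : IsCompactOperator K) {z : ℂ}
    (hB : z ∈ resolventSet ℂ B) (hz : z ∈ spectrum ℂ (B + K)) :
    Module.End.HasEigenvalue ((B + K : E →L[ℂ] E) : Module.End ℂ E) z := by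
  obtain ⟨R, hR⟩ := spectrum.mem_resolventSet_iff.1 hB
  have hT : IsCompactOperator ((↑R⁻¹ : E →L[ℂ] E) * K : E →L[ℂ] E) := hK.clm_comp _
  -- With `R = z - B` invertible, everything reduces to the Fredholm alternative for the compact
  -- `R⁻¹ K` at 1.
  have fac : algebraMap ℂ (E →L[ℂ] E) z - (B + K)
      = R * (algebraMap ℂ (E →L[ℂ] E) 1 - (↑R⁻¹ : E →L[ℂ] E) * K) := by
    rw [mul_sub, ← mul_assoc, R.mul_inv, one_mul, hR, map_one, mul_one, sub_sub]
  rcases hT.hasEigenvalue_or_mem_resolventSet one_ne_zero with he | hr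
  · obtain ⟨f, hf⟩ := he.exists_hasEigenvector
    refine Module.End.hasEigenvalue_of_hasEigenvector (x := f) ⟨?_, hf.2⟩
    rw [Module.End.mem_eigenspace_iff]
    have h1 : ((↑R⁻¹ : E →L[ℂ] E) * K) f = f := by simpa using hf.apply_eq_smul
    have h2 : (algebraMap ℂ (E →L[ℂ] E) z - (B + K)) f = 0 := by
      rw [fac, mul_apply_eq_comp, sub_apply, h1]
      simp
    rw [sub_apply, sub_eq_zero] at h2
    simpa [Algebra.algebraMap_eq_smul_one] using h2.symm
  · exfalso
    refine hz ?_
    rw [spectrum.mem_resolventSet_iff] at hr ⊢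
    rw [fac]
    exact R.isUnit.mul hr

theorem mem_spectrum_of_hasEigenvalue {E : Type*} [NormedAddCommGroup E] [NormedSpace ℂ E]
    {A : E →L[ℂ] E} {z : ℂ} (h : Module.End.HasEigenvalue A.toLinearMap z) :
    z ∈ spectrum ℂ A := by
  intro hr
  obtain ⟨f, hf⟩ := h.exists_hasEigenvector
  have hA : A f = z • f := hf.apply_eq_smul
  obtain ⟨R, hR⟩ := spectrum.mem_resolventSet_iff.1 hr
  have h1 : (R : E →L[ℂ] E) f = 0 := by
    rw [hR, sub_apply, hA, Algebra.algebraMap_eq_smul_one]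
    simp
  refine hf.2 ?_
  calc f = ((↑R⁻¹ : E →L[ℂ] E) * (R : E →L[ℂ] E)) f := by rw [R.inv_mul]; rfl
    _ = 0 := by rw [mul_apply_eq_comp, h1, map_zero]

/-- An operator on `ℓ²(V)` all of whose values are supported in one finite set is compact. -/
theorem isCompactOperator_of_finite_support {E : Type*} [NormedAddCommGroup E] [NormedSpace ℂ E]
    (K : E →L[ℂ] lp (fun _ : V => ℂ) 2) (S : Finset V) (hS : ∀ f, ∀ v ∉ S, K f v = 0) :
    IsCompactOperator K := by
  let F : Submodule ℂ (lp (fun _ : V => ℂ) 2) :=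
    { carrier := {g | ∀ v ∉ S, g v = 0}
      add_mem' := fun {a b} ha hb v hv => by simp [ha v hv, hb v hv]
      zero_mem' := fun v _ => by simp
      smul_mem' := fun c a ha v hv => by simp [ha v hv] }
  let φ : F →ₗ[ℂ] (S → ℂ) :=
    { toFun := fun g v => g.1 v
      map_add' := fun a b => by ext v; simp
      map_smul' := fun c a => by ext v; simp }
  -- The coordinates in `S` separate `F`, so `F` is finite-dimensional and `K` factors through it.
  have hφ : Function.Injective φ := by
    intro a b hab
    apply Subtype.ext
    ext v
    by_cases hv : v ∈ S
    · exact congrFun hab ⟨v, hv⟩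
    · rw [a.2 v hv, b.2 v hv]
  have : FiniteDimensional ℂ F := FiniteDimensional.of_injective φ hφ
  have : ProperSpace F := FiniteDimensional.proper ℂ F
  have hc : IsCompactOperator (K.codRestrict F hS) :=
    isCompactOperator_of_locallyCompactSpace_dom _
  exact hc.clm_comp F.subtypeL

end General

/-! ### The eigenvalue equation on the graph in coordinates -/

section Graph

variable {n : ℕ} {k : Fin n → ℕ}

theorem multipleStarRay_adj_inr_inr (a b : ℕ) :
    (multipleStarRay k).Adj (Sum.inr a) (Sum.inr b) ↔ b = a + 1 ∨ a = b + 1 := by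
  simp only [multipleStarRay, coupling, ray, SimpleGraph.sup_adj, SimpleGraph.sum_adj,
    SimpleGraph.hasse_adj, Nat.covBy_iff_add_one_eq, SimpleGraph.edge_adj]
  simp [eq_comm]

theorem multipleStarRay_adj_inl_inr (a : Option (Σ j : Fin n, Fin (k j))) (b : ℕ) :
    (multipleStarRay k).Adj (Sum.inl a) (Sum.inr b) ↔ a = none ∧ b = 0 := by
  simp [multipleStarRay, coupling, SimpleGraph.edge_adj]

theorem multipleStarRay_adj_none_some (j : Fin n) (i : Fin (k j)) :
    (multipleStarRay k).Adj (Sum.inl none) (Sum.inl (some ⟨j, i⟩)) ↔ i.val = 0 := by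
  simp only [multipleStarRay, coupling, multipleStar, SimpleGraph.sup_adj,
    SimpleGraph.sum_adj, SimpleGraph.fromRel_adj, SimpleGraph.edge_adj]
  constructor
  · rintro (⟨-, (⟨j', i', -, h, h0⟩ | ⟨j', i', i'', h, -⟩) | (⟨j', i', h, -⟩ | ⟨j', i', i'', -, h, -⟩)⟩ | h)
    · cases h
      exact h0
    all_goals simp_all
  · intro h
    exact Or.inl ⟨by simp, Or.inl (Or.inl ⟨j, i, trivial, rfl, h⟩)⟩

theorem multipleStarRay_adj_some_some (j j' : Fin n) (i : Fin (k j)) (i' : Fin (k j')) :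
    (multipleStarRay k).Adj (Sum.inl (some ⟨j, i⟩)) (Sum.inl (some ⟨j', i'⟩)) ↔
      j = j' ∧ (i'.val = i.val + 1 ∨ i.val = i'.val + 1) := by
  simp only [multipleStarRay, coupling, multipleStar, SimpleGraph.sup_adj,
    SimpleGraph.sum_adj, SimpleGraph.fromRel_adj, SimpleGraph.edge_adj]
  constructor
  · rintro (⟨-, (⟨_, _, h, -⟩ | ⟨_, _, _, h, h', h0⟩) | (⟨_, _, h, -⟩ | ⟨_, _, _, h, h', h0⟩)⟩ | h)
    · simp at h
    · cases h
      cases h'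
      exact ⟨rfl, Or.inl h0⟩
    · simp at h
    · cases h
      cases h'
      exact ⟨rfl, Or.inr h0⟩
    · simp at h
  · rintro ⟨rfl, h | h⟩
    · refine Or.inl ⟨?_, Or.inl (Or.inr ⟨j, i, i', rfl, rfl, h⟩)⟩
      intro e
      cases e
      omega
    · refine Or.inl ⟨?_, Or.inr (Or.inr ⟨j, i', i, rfl, rfl, h⟩)⟩
      intro e
      cases e
      omega

/-- The values of `f` along the tail, starting from the root. -/
def tailValues (f : Option (Σ j : Fin n, Fin (k j)) ⊕ ℕ → ℂ) : ℕ → ℂ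
  | 0 => f (Sum.inl none)
  | m + 1 => f (Sum.inr m)

/-- The values of `f` along the `j`-th leg of the star, starting from the root and extended
by zero. -/
def legValues (f : Option (Σ j : Fin n, Fin (k j)) ⊕ ℕ → ℂ) (j : Fin n) : ℕ → ℂ
  | 0 => f (Sum.inl none)
  | m + 1 => if h : m < k j then f (Sum.inl (some ⟨j, ⟨m, h⟩⟩)) else 0

variable (f : lp (fun _ : Option (Σ j : Fin n, Fin (k j)) ⊕ ℕ => ℂ) 2)

/-- Tail index `m + 1` is ray vertex `m`; with the root at index 0, the end of the ray needs no
separate formula. -/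
theorem multipleStarRayOperator_apply_inr (m : ℕ) :
    multipleStarRayOperator k f (Sum.inr m) = tailValues f m + tailValues f (m + 2) := by
  rw [multipleStarRayOperator, adjacencyOperator_apply]
  cases m with
  | zero =>
    rw [tailValues, tailValues, ← Finset.sum_pair (f := f) (by simp)]
    refine Finset.sum_congr ?_ fun _ _ => rfl
    ext (x | x)
    · rw [UniformlyLocallyFinite.mem_nbrs, SimpleGraph.adj_comm, multipleStarRay_adj_inl_inr]
      simp
    · rw [UniformlyLocallyFinite.mem_nbrs, multipleStarRay_adj_inr_inr]
      simp
  | succ m =>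
    rw [tailValues, tailValues, ← Finset.sum_pair (f := f) (by simp)]
    refine Finset.sum_congr ?_ fun _ _ => rfl
    ext (x | x)
    · rw [UniformlyLocallyFinite.mem_nbrs, SimpleGraph.adj_comm, multipleStarRay_adj_inl_inr]
      simp
    · rw [UniformlyLocallyFinite.mem_nbrs, multipleStarRay_adj_inr_inr]
      simp
      omega

theorem multipleStarRayOperator_apply_root (hk : ∀ j, 1 ≤ k j) :
    multipleStarRayOperator k f (Sum.inl none) = tailValues f 1 + ∑ j, legValues f j 1 := by
  rw [multipleStarRayOperator, adjacencyOperator_apply]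
  let s : Fin n → Option (Σ j : Fin n, Fin (k j)) ⊕ ℕ := fun j => Sum.inl (some ⟨j, ⟨0, hk j⟩⟩)
  have hs : Function.Injective s := by
    intro a b hab
    simp only [s, Sum.inl.injEq, Option.some.injEq, Sigma.mk.injEq] at hab
    exact hab.1
  have e : ∑ j, legValues f j 1 = ∑ x ∈ Finset.univ.image s, f x := by
    rw [Finset.sum_image hs.injOn]
    refine Finset.sum_congr rfl fun j _ => ?_
    exact dif_pos (hk j)
  rw [e, tailValues, ← Finset.sum_insert (by simp [s])]
  refine Finset.sum_congr ?_ fun _ _ => rfl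
  ext (x | x)
  · rw [UniformlyLocallyFinite.mem_nbrs]
    rcases x with _ | ⟨j, i⟩
    · simp [s]
    · rw [multipleStarRay_adj_none_some]
      simp only [Finset.mem_insert, reduceCtorEq, Finset.mem_image, Finset.mem_univ, true_and,
        false_or, s, Sum.inl.injEq, Option.some.injEq]
      constructor
      · intro h
        exact ⟨j, by congr 1; exact Fin.ext h.symm⟩
      · rintro ⟨j', h⟩
        cases h
        rfl
  · rw [UniformlyLocallyFinite.mem_nbrs, multipleStarRay_adj_inl_inr]
    simp [s]

/-- Leg index `i + 1` is vertex `i`; at the leaf the missing outer neighbour is replaced by the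
default value 0 at index `k j + 1`. -/
theorem multipleStarRayOperator_apply_leg (j : Fin n) (i : Fin (k j)) :
    multipleStarRayOperator k f (Sum.inl (some ⟨j, i⟩))
      = legValues f j i + legValues f j (i + 2) := by
  classical
  rw [multipleStarRayOperator, adjacencyOperator_apply]
  obtain ⟨i, hi⟩ := i
  have key : ∀ s : Finset (Option (Σ j : Fin n, Fin (k j)) ⊕ ℕ),
      (Sum.inl none ∈ s ↔ i = 0) → (∀ m, Sum.inr m ∉ s) →
      (∀ j' i', Sum.inl (some ⟨j', i'⟩) ∈ s ↔
        j = j' ∧ (i'.val = i + 1 ∨ i = i'.val + 1)) →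
      (uniformlyLocallyFinite_multipleStarRay k).nbrs (Sum.inl (some ⟨j, ⟨i, hi⟩⟩)) = s := by
    intro s h1 h2 h3
    ext (x | x)
    · rw [UniformlyLocallyFinite.mem_nbrs]
      rcases x with _ | ⟨j', i'⟩
      · rw [SimpleGraph.adj_comm, multipleStarRay_adj_none_some, h1]
      · rw [multipleStarRay_adj_some_some, h3]
    · rw [UniformlyLocallyFinite.mem_nbrs, multipleStarRay_adj_inl_inr]
      simp [h2]
  have eqv : ∀ (m : ℕ) (hm : m < k j) (j' : Fin n) (i' : Fin (k j')),
      (⟨j', i'⟩ : Σ j : Fin n, Fin (k j)) = ⟨j, ⟨m, hm⟩⟩ ↔ j = j' ∧ i'.val = m := by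
    intro m hm j' i'
    constructor
    · intro h
      cases h
      exact ⟨rfl, rfl⟩
    · rintro ⟨rfl, h⟩
      congr 1
      exact Fin.ext h
  cases i with
  | zero =>
    by_cases h : 1 < k j
    · rw [key {Sum.inl none, Sum.inl (some ⟨j, ⟨1, h⟩⟩)} (by simp) (by simp)
        (fun j' i' => by simp [eqv]), Finset.sum_pair (by simp)]
      simp [legValues, h]
    · rw [key {Sum.inl none} (by simp) (by simp)
        (fun j' i' => by simp; rintro rfl; omega), Finset.sum_singleton]
      simp [legValues, h]
  | succ i =>
    have h' : i < k j := by omega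
    by_cases h : i + 2 < k j
    · rw [key {Sum.inl (some ⟨j, ⟨i, h'⟩⟩), Sum.inl (some ⟨j, ⟨i + 2, h⟩⟩)} (by simp) (by simp)
        (fun j' i' => by simp [eqv, ← and_or_left]; intro; omega), Finset.sum_pair (by simp)]
      simp [legValues, h, h']
    · rw [key {Sum.inl (some ⟨j, ⟨i, h'⟩⟩)} (by simp) (by simp)
        (fun j' i' => by simp [eqv]; rintro rfl; omega), Finset.sum_singleton]
      simp [legValues, h, h']

/-- Decouples the equation into one-dimensional recurrences linked only through the root. -/
theorem multipleStarRayOperator_apply_eq_smul_iff (hk : ∀ j, 1 ≤ k j) (z : ℂ) :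
    multipleStarRayOperator k f = z • f ↔
      (∀ m, tailValues f m + tailValues f (m + 2) = z * tailValues f (m + 1)) ∧
      tailValues f 1 + ∑ j, legValues f j 1 = z * f (Sum.inl none) ∧
      ∀ j, ∀ i < k j, legValues f j i + legValues f j (i + 2) = z * legValues f j (i + 1) := by
  constructor
  · intro h
    refine ⟨fun m => ?_, ?_, fun j i hi => ?_⟩
    · rw [← multipleStarRayOperator_apply_inr, h]
      rfl
    · rw [← multipleStarRayOperator_apply_root f hk, h]
      rfl
    · have := multipleStarRayOperator_apply_leg f j ⟨i, hi⟩
      rw [← this, h, legValues, dif_pos hi]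
      rfl
  · rintro ⟨h1, h2, h3⟩
    ext ((_ | ⟨j, i⟩) | m)
    · rw [multipleStarRayOperator_apply_root f hk, h2]
      rfl
    · rw [multipleStarRayOperator_apply_leg, h3 j i i.2, legValues, dif_pos i.2]
      rfl
    · rw [multipleStarRayOperator_apply_inr, h1]
      rfl

/-- Outside the disc of radius two, every spectral value is an eigenvalue. -/
theorem hasEigenvalue_multipleStarRayOperator_of_mem_spectrum {z : ℂ} (hz : 2 < ‖z‖)
    (h : z ∈ spectrum ℂ (multipleStarRayOperator k)) :
    Module.End.HasEigenvalue (multipleStarRayOperator k).toLinearMap z := by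
  classical
  let G : SimpleGraph (Option (Σ j : Fin n, Fin (k j)) ⊕ ℕ) := SimpleGraph.sum ⊥ ray
  have hadj : ∀ a b : ℕ, G.Adj (Sum.inr a) (Sum.inr b) ↔ b = a + 1 ∨ a = b + 1 := by
    intro a b
    simp only [G, ray, SimpleGraph.sum_adj, SimpleGraph.hasse_adj,
      Nat.covBy_iff_add_one_eq]
    simp [eq_comm]
  have hsub : ∀ v, ∃ t : Finset (Option (Σ j : Fin n, Fin (k j)) ⊕ ℕ),
      t.card ≤ 2 ∧ G.neighborSet v ⊆ t := by
    rintro (a | a)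
    · refine ⟨∅, by simp, ?_⟩
      rintro (b | b) hb <;> simp [G] at hb
    -- Truncated subtraction at `a = 0` only adds a spurious vertex to the upper bound.
    · refine ⟨{Sum.inr (a - 1), Sum.inr (a + 1)}, Finset.card_le_two, ?_⟩
      rintro (b | b) hb
      · simp [G] at hb
      · rw [SimpleGraph.mem_neighborSet, hadj] at hb
        simp
        omega
  have hG : UniformlyLocallyFinite G := by
    refine ⟨2, fun v => ?_⟩
    obtain ⟨t, ht, hv⟩ := hsub v
    refine (Set.encard_le_encard hv).trans ?_
    rw [Set.encard_coe_eq_coe_finsetCard]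
    exact_mod_cast ht
  have hcard : ∀ v, (hG.nbrs v).card ≤ 2 := by
    intro v
    obtain ⟨t, ht, hv⟩ := hsub v
    exact (Finset.card_le_card fun w hw => hv (hG.mem_nbrs.1 hw)).trans ht
  let B := adjacencyOperator G hG
  -- The endpoints of deleted edges: star vertices, and ray vertex 0 because of the bridge.
  let S : Finset (Option (Σ j : Fin n, Fin (k j)) ⊕ ℕ) :=
    insert (Sum.inr 0) (Finset.univ.image Sum.inl)
  have hB : z ∈ resolventSet ℂ B := by
    refine spectrum.mem_resolventSet_of_norm_lt_mul (lt_of_le_of_lt ?_ hz)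
    have h1 : ‖B‖ ≤ 2 := norm_adjacencyOperator_le G hG hcard
    exact (mul_le_of_le_one_right (norm_nonneg _) ContinuousLinearMap.norm_id_le).trans h1
  have hK : IsCompactOperator (multipleStarRayOperator k - B) := by
    refine isCompactOperator_of_finite_support _ S fun f v hv => ?_
    rcases v with a | a
    · simp [S] at hv
    · obtain ⟨m, rfl⟩ : ∃ m, a = m + 1 :=
        Nat.exists_eq_succ_of_ne_zero (by rintro rfl; simp [S] at hv)
      rw [sub_apply, lp.coeFn_sub, Pi.sub_apply, sub_eq_zero]
      rw [multipleStarRayOperator, adjacencyOperator_apply, adjacencyOperator_apply]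
      refine Finset.sum_congr ?_ fun _ _ => rfl
      ext (b | b)
      · rw [UniformlyLocallyFinite.mem_nbrs, UniformlyLocallyFinite.mem_nbrs,
          SimpleGraph.adj_comm, multipleStarRay_adj_inl_inr]
        simp [G]
      · rw [UniformlyLocallyFinite.mem_nbrs, UniformlyLocallyFinite.mem_nbrs,
          multipleStarRay_adj_inr_inr, hadj]
  have e : multipleStarRayOperator k = B + (multipleStarRayOperator k - B) := by abel
  rw [e] at h ⊢
  exact hasEigenvalue_of_mem_spectrum_add hK hB h

end Graph

/-! ### The star equation as a real equation -/

section Scalar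

/-- The finite continued fractions `1 / (2 cosh t - 1 / (2 cosh t - ⋯))`. -/
def legFraction : ℕ → ℝ → ℝ
  | 0, _ => 0
  | m + 1, t => (2 * Real.cosh t - legFraction m t)⁻¹

/-- Since `2 cosh t ≥ 2`, a fraction below 1 leaves a denominator above 1, which keeps the next
fraction below 1. -/
theorem legFraction_mem_Ico (m : ℕ) (t : ℝ) : legFraction m t ∈ Set.Ico 0 1 := by
  induction m with
  | zero => simp [legFraction]
  | succ m ih =>
    have h : 1 < 2 * Real.cosh t - legFraction m t := by
      linarith [Real.one_le_cosh t, ih.2]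
    exact ⟨inv_nonneg.2 (by linarith), inv_lt_one_of_one_lt₀ h⟩

theorem legFraction_denom_pos (m : ℕ) (t : ℝ) : 0 < 2 * Real.cosh t - legFraction m t := by
  linarith [Real.one_le_cosh t, (legFraction_mem_Ico m t).2]

theorem continuous_legFraction (m : ℕ) : Continuous (legFraction m) := by
  induction m with
  | zero => exact continuous_const
  | succ m ih =>
    exact ((continuous_const.mul Real.continuous_cosh).sub ih).inv₀
      fun t => (legFraction_denom_pos m t).ne'

theorem antitoneOn_legFraction (m : ℕ) : AntitoneOn (legFraction m) (Set.Ici 0) := by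
  induction m with
  | zero => exact fun _ _ _ _ _ => le_rfl
  | succ m ih =>
    intro a ha b hb hab
    refine inv_anti₀ (legFraction_denom_pos m a) ?_
    have : Real.cosh a ≤ Real.cosh b := by
      rw [Real.cosh_le_cosh, abs_of_nonneg ha, abs_of_nonneg hb]
      exact hab
    linarith [ih ha hb hab]

/-- Supplies the limit at 0, where the quotient of hyperbolic sines is `0 / 0`. -/
theorem legFraction_zero_right (m : ℕ) : legFraction m 0 = m / (m + 1) := by
  induction m with
  | zero => simp [legFraction]
  | succ m ih =>
    have : (m : ℝ) + 1 ≠ 0 := by positivity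
    have h2 : (m : ℝ) + 2 ≠ 0 := by positivity
    have e : 2 * Real.cosh 0 - legFraction m 0 = (m + 2) / (m + 1) := by
      rw [ih, Real.cosh_zero]
      field_simp
      ring
    rw [legFraction, e, inv_div]
    push_cast
    congr 1
    ring

theorem sinh_natCast_add_one_mul_pos (m : ℕ) {t : ℝ} (ht : 0 < t) :
    0 < Real.sinh (((m : ℝ) + 1) * t) :=
  Real.sinh_pos_iff.2 (by positivity)

theorem sinh_recurrence (a t : ℝ) :
    Real.sinh (a * t) + Real.sinh ((a + 2) * t) = 2 * Real.cosh t * Real.sinh ((a + 1) * t) := by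
  rw [show a * t = (a + 1) * t - t by ring, show (a + 2) * t = (a + 1) * t + t by ring,
    Real.sinh_sub, Real.sinh_add]
  ring

/-- Dividing the three-term recurrence for `sinh` by its middle term gives the continued fraction.
-/
theorem sinh_div_sinh_eq_legFraction (m : ℕ) {t : ℝ} (ht : 0 < t) :
    Real.sinh (m * t) / Real.sinh ((m + 1) * t) = legFraction m t := by
  induction m with
  | zero => simp [legFraction]
  | succ m ih =>
    have h1 := sinh_natCast_add_one_mul_pos m ht
    rw [legFraction, ← ih, ← inv_div]
    push_cast
    congr 1
    rw [div_eq_iff h1.ne', sub_mul, div_mul_cancel₀ _ h1.ne', ← sinh_recurrence]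
    ring_nf

variable {n : ℕ} {k : Fin n → ℕ}

theorem starEquation_iff {t : ℝ} (ht : 0 < t) :
    StarEquation k t ↔ ∑ j, legFraction (k j) t = Real.exp t := by
  simp only [StarEquation, sinh_div_sinh_eq_legFraction _ ht]

/-- Each term is at least `1 / 2`, which suffices for `n ≥ 3`; for `n = 2` some leg has length at
least 2 and contributes strictly more. -/
theorem one_lt_sum_legFraction_zero (hn : 2 ≤ n) (hk : ∀ j, 1 ≤ k j)
    (hne : ¬ (n = 2 ∧ ∀ j, k j = 1)) : 1 < ∑ j, legFraction (k j) 0 := by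
  have hge : ∀ j, (1 / 2 : ℝ) ≤ legFraction (k j) 0 := by
    intro j
    have : (1 : ℝ) ≤ k j := by exact_mod_cast hk j
    rw [legFraction_zero_right, div_le_div_iff₀ (by norm_num) (by positivity)]
    linarith
  have hsum : ∑ _j : Fin n, (1 / 2 : ℝ) = n / 2 := by
    simp
    ring
  rcases hn.lt_or_eq with h | rfl
  · have h3 : (3 : ℝ) ≤ n := by exact_mod_cast h
    calc (1 : ℝ) < n / 2 := by linarith
      _ = ∑ _j : Fin n, (1 / 2 : ℝ) := hsum.symm
      _ ≤ _ := Finset.sum_le_sum fun j _ => hge j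
  · obtain ⟨j, hj⟩ : ∃ j, k j ≠ 1 := by
      by_contra! h
      exact hne ⟨rfl, h⟩
    have hgt : (1 / 2 : ℝ) < legFraction (k j) 0 := by
      have : (2 : ℝ) ≤ k j := by
        have := hk j
        exact_mod_cast (show 2 ≤ k j by omega)
      rw [legFraction_zero_right, div_lt_div_iff₀ (by norm_num) (by positivity)]
      linarith
    calc (1 : ℝ) = ∑ _j : Fin 2, (1 / 2 : ℝ) := by rw [hsum]; norm_num
      _ < _ := Finset.sum_lt_sum (fun j _ => hge j) ⟨j, Finset.mem_univ _, hgt⟩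

/-- The star equation has a unique positive solution. -/
theorem exists_unique_starEquation (hn : 2 ≤ n) (hk : ∀ j, 1 ≤ k j)
    (hne : ¬ (n = 2 ∧ ∀ j, k j = 1)) :
    ∃ tp : ℝ, 0 < tp ∧ StarEquation k tp ∧ ∀ t : ℝ, 0 < t → StarEquation k t → t = tp := by
  let g : ℝ → ℝ := fun t => Real.exp t - ∑ j, legFraction (k j) t
  have hcont : Continuous g :=
    Real.continuous_exp.sub (continuous_finsetSum _ fun j _ => continuous_legFraction (k j))
  have hmono : StrictMonoOn g (Set.Ici 0) := by
    intro a ha b hb hab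
    have h : ∑ j, legFraction (k j) b ≤ ∑ j, legFraction (k j) a :=
      Finset.sum_le_sum fun j _ => antitoneOn_legFraction (k j) ha hb hab.le
    have := Real.exp_lt_exp.2 hab
    simp only [g]
    linarith
  have h0 : g 0 < 0 := by
    have := one_lt_sum_legFraction_zero hn hk hne
    simp only [g, Real.exp_zero]
    linarith
  -- At `t = n` the sum is at most `n < n + 1 ≤ exp n`.
  have h1 : 0 < g n := by
    have : ∑ j, legFraction (k j) n ≤ ∑ _j : Fin n, (1 : ℝ) :=
      Finset.sum_le_sum fun j _ => (legFraction_mem_Ico (k j) n).2.le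
    have h2 := Real.add_one_le_exp (n : ℝ)
    simp at this
    simp only [g]
    linarith
  obtain ⟨tp, htp, hg⟩ := intermediate_value_Ioo (Nat.cast_nonneg n) hcont.continuousOn ⟨h0, h1⟩
  refine ⟨tp, htp.1, (starEquation_iff htp.1).2 (sub_eq_zero.1 hg).symm, fun t ht hs => ?_⟩
  refine hmono.injOn (Set.mem_Ici.2 ht.le) (Set.mem_Ici.2 htp.1.le) ?_
  rw [hg]
  exact sub_eq_zero.2 ((starEquation_iff ht).1 hs).symm

/-- For legs of equal length the star equation is algebraic in `exp (-t)`. -/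
theorem starEquation_iff_of_eq {p : ℕ} (hp : ∀ j, k j = p) {t : ℝ} (ht : 0 < t) :
    StarEquation k t ↔
      ((n : ℝ) - 1) * Real.exp (-t) ^ (2 * p + 2) - (n : ℝ) * Real.exp (-t) ^ 2 + 1 = 0 := by
  have hs := sinh_natCast_add_one_mul_pos p ht
  simp only [StarEquation, hp, Finset.sum_const, Finset.card_univ, Fintype.card_fin, nsmul_eq_mul]
  rw [← mul_div_assoc, div_eq_iff hs.ne', Real.sinh_eq, Real.sinh_eq]
  have hx : Real.exp t ≠ 0 := (Real.exp_pos t).ne'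
  have e1 : Real.exp (p * t) = Real.exp t ^ p := by rw [← Real.exp_nat_mul]
  have e2 : Real.exp ((p + 1) * t) = Real.exp t ^ (p + 1) := by
    rw [← Real.exp_nat_mul]; push_cast; rfl
  rw [Real.exp_neg (p * t), Real.exp_neg ((p + 1) * t), e1, e2, Real.exp_neg t]
  set y := Real.exp t
  have key : (n : ℝ) * ((y ^ p - (y ^ p)⁻¹) / 2) - y * ((y ^ (p + 1) - (y ^ (p + 1))⁻¹) / 2)
      = -(y ^ (p + 2) / 2) *
        (((n : ℝ) - 1) * y⁻¹ ^ (2 * p + 2) - (n : ℝ) * y⁻¹ ^ 2 + 1) := by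
    simp only [inv_pow]
    field_simp
    ring
  rw [← sub_eq_zero, key, mul_eq_zero, or_iff_right]
  exact neg_ne_zero.2 (by positivity)

end Scalar

/-! ### Three-term recurrences on the tail and on a leg -/

section Recurrence

/-- A solution of the free recurrence with null limit is geometric. -/
theorem eq_mul_of_recurrence_of_tendsto_zero {x : ℂ} (hx0 : x ≠ 0) (hx1 : ‖x‖ < 1) {w : ℕ → ℂ}
    (hrec : ∀ m, w m + w (m + 2) = (x + x⁻¹) * w (m + 1))
    (hlim : Filter.Tendsto w Filter.atTop (nhds 0)) : w 1 = x * w 0 ∧ (w 0 = 0 → ∀ m, w m = 0) := by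
  -- Subtracting `x * w m` kills the decaying mode; what is left grows by `x⁻¹` per step, so its
  -- product with `x ^ m` is constant, and the null limit forces it to be 0.
  have hd : ∀ m, w 1 - x * w 0 = x ^ m * (w (m + 1) - x * w m) := by
    intro m
    induction m with
    | zero => simp
    | succ m ih =>
      have e : w (m + 2) = (x + x⁻¹) * w (m + 1) - w m := by rw [← hrec m]; ring
      rw [ih, e, pow_succ]
      field_simp
      ring
  have ht : Filter.Tendsto (fun m => x ^ m * (w (m + 1) - x * w m)) Filter.atTop (nhds 0) := by
    have h1 := tendsto_pow_atTop_nhds_zero_of_norm_lt_one hx1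
    have h2 := (hlim.comp (Filter.tendsto_add_atTop_nat 1)).sub (hlim.const_mul x)
    simpa using h1.mul h2
  have h0 : w 1 - x * w 0 = 0 := by
    refine tendsto_nhds_unique ?_ ht
    exact tendsto_const_nhds.congr hd
  refine ⟨sub_eq_zero.1 h0, fun hw m => ?_⟩
  induction m with
  | zero => exact hw
  | succ m ih =>
    have := hd m
    rw [h0, ih] at this
    simpa [hx0] using this.symm

/-- Two solutions of the free recurrence on a finite segment that vanish at its far end, resp. at
the origin, are reversals of each other up to a factor. -/
theorem mul_eq_of_recurrence_reverse {z : ℂ} {u r : ℕ → ℂ} {K : ℕ}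
    (hu : ∀ i < K, u i + u (i + 2) = z * u (i + 1)) (huK : u (K + 1) = 0)
    (hr : ∀ m, r m + r (m + 2) = z * r (m + 1)) (hr0 : r 0 = 0) :
    ∀ m i, i + m = K + 1 → u i * r 1 = u K * r m := by
  -- The recurrence is of second order, so the induction carries two consecutive indices.
  have key : ∀ m, (∀ i, i + m = K + 1 → u i * r 1 = u K * r m) ∧
      (∀ i, i + (m + 1) = K + 1 → u i * r 1 = u K * r (m + 1)) := by
    intro m
    induction m with
    | zero =>
      refine ⟨fun i hi => ?_, fun i hi => ?_⟩
      · obtain rfl : i = K + 1 := by omega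
        rw [huK, hr0, zero_mul, mul_zero]
      · obtain rfl : i = K := by omega
        rfl
    | succ m ih =>
      refine ⟨ih.2, fun i hi => ?_⟩
      have h1 := hu i (by omega)
      have h2 := ih.1 (i + 2) (by omega)
      have h3 := ih.2 (i + 1) (by omega)
      have h4 := hr m
      linear_combination r 1 * h1 - h2 + z * h3 - u K * h4
  exact fun m => (key m).1

end Recurrence

/-! ### Eigenvectors and the spectrum off the band -/

section Eigen

/-- The solution `ε ^ m * sinh (m t)` of the recurrence at energy `2 ε cosh t`. -/
def signedSinh (ε t : ℝ) (m : ℕ) : ℝ :=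
  ε ^ m * Real.sinh (m * t)

theorem signedSinh_zero (ε t : ℝ) : signedSinh ε t 0 = 0 := by
  simp [signedSinh]

theorem signedSinh_recurrence {ε : ℝ} (hε : ε ^ 2 = 1) (t : ℝ) (m : ℕ) :
    signedSinh ε t m + signedSinh ε t (m + 2)
      = ε * (2 * Real.cosh t) * signedSinh ε t (m + 1) := by
  have h := sinh_recurrence m t
  simp only [signedSinh]
  push_cast
  rw [pow_add ε m 2, hε, pow_succ]
  linear_combination ε ^ m * h + (-2 * ε ^ m * Real.cosh t * Real.sinh ((m + 1) * t)) * hε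

theorem signedSinh_succ_ne_zero {ε : ℝ} (hε : ε ^ 2 = 1) {t : ℝ} (ht : 0 < t) (m : ℕ) :
    signedSinh ε t (m + 1) ≠ 0 := by
  have h0 : ε ≠ 0 := by
    rintro rfl
    norm_num at hε
  refine mul_ne_zero (pow_ne_zero _ h0) ?_
  push_cast
  exact (sinh_natCast_add_one_mul_pos m ht).ne'

/-- The powers of the sign leave `ε⁻¹ = ε`, the same factor on every leg, which later cancels. -/
theorem signedSinh_div {ε : ℝ} (hε : ε ^ 2 = 1) {t : ℝ} (ht : 0 < t) (m : ℕ) :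
    signedSinh ε t m / signedSinh ε t (m + 1)
      = ε * (Real.sinh (m * t) / Real.sinh ((m + 1) * t)) := by
  have h1 := signedSinh_succ_ne_zero hε ht m
  have h2 := (sinh_natCast_add_one_mul_pos m ht).ne'
  rw [div_eq_iff h1, ← mul_div_assoc, div_mul_eq_mul_div, eq_div_iff h2]
  simp only [signedSinh]
  push_cast
  rw [pow_succ]
  linear_combination (-ε ^ m * Real.sinh (m * t) * Real.sinh ((m + 1) * t)) * hε

variable {n : ℕ} {k : Fin n → ℕ}

theorem tendsto_tailValues (f : lp (fun _ : Option (Σ j : Fin n, Fin (k j)) ⊕ ℕ => ℂ) 2) :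
    Filter.Tendsto (tailValues f) Filter.atTop (nhds 0) := by
  rw [← Filter.tendsto_add_atTop_iff_nat 1]
  have h1 : Summable fun v => ‖f v‖ ^ 2 := by
    simpa using (lp.memℓp f).summable (by norm_num)
  have h2 : Filter.Tendsto (fun m : ℕ => ‖f (Sum.inr m)‖ ^ 2) Filter.atTop (nhds 0) :=
    (h1.comp_injective Sum.inr_injective).tendsto_atTop_zero
  have h3 := h2.sqrt
  simp only [Real.sqrt_sq (norm_nonneg _), Real.sqrt_zero] at h3
  exact tendsto_zero_iff_norm_tendsto_zero.2 h3

theorem norm_mul_exp_neg_lt_one {ε : ℝ} (hε : ε ^ 2 = 1) {t : ℝ} (ht : 0 < t) :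
    |ε * Real.exp (-t)| < 1 := by
  have h : |ε| = 1 := by
    rw [← sq_eq_sq₀ (abs_nonneg _) zero_le_one, sq_abs, hε, one_pow]
  rw [abs_mul, h, one_mul, abs_of_pos (Real.exp_pos _)]
  simpa using ht

theorem energy_eq {ε : ℝ} (hε : ε ^ 2 = 1) (t : ℝ) :
    ε * (2 * Real.cosh t) = ε * Real.exp (-t) + (ε * Real.exp (-t))⁻¹ := by
  have h : ε⁻¹ = ε := inv_eq_of_mul_eq_one_left (by rw [← sq, hε])
  rw [mul_inv, h, Real.exp_neg, inv_inv, Real.cosh_eq, Real.exp_neg]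
  ring

section Forward

variable (hk : ∀ j, 1 ≤ k j) {ε : ℝ} (hε : ε ^ 2 = 1) {t : ℝ} (ht : 0 < t)
  {f : lp (fun _ : Option (Σ j : Fin n, Fin (k j)) ⊕ ℕ => ℂ) 2}
  (hf : multipleStarRayOperator k f = ((ε * (2 * Real.cosh t) : ℝ) : ℂ) • f)

include hk hε ht hf

theorem tailValues_of_eigenvector :
    tailValues f 1 = ((ε * Real.exp (-t) : ℝ) : ℂ) * f (Sum.inl none) ∧
      (f (Sum.inl none) = 0 → ∀ m, tailValues f m = 0) := by
  have hx : ε * Real.exp (-t) ≠ 0 := by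
    refine mul_ne_zero ?_ (Real.exp_pos _).ne'
    rintro rfl
    norm_num at hε
  refine eq_mul_of_recurrence_of_tendsto_zero (Complex.ofReal_ne_zero.2 hx) ?_ ?_
    (tendsto_tailValues f)
  · rw [Complex.norm_real]
    exact norm_mul_exp_neg_lt_one hε ht
  · have h := ((multipleStarRayOperator_apply_eq_smul_iff f hk _).1 hf).1
    rw [energy_eq hε] at h
    exact_mod_cast h

/-- The reversal identity at `i` and at the root both involve the leaf value; eliminating it
expresses the leg through the root. -/
theorem legValues_of_eigenvector (j : Fin n) (m i : ℕ) (hmi : i + m = k j + 1) :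
    legValues f j i * signedSinh ε t (k j + 1) = f (Sum.inl none) * signedSinh ε t m := by
  have h := ((multipleStarRayOperator_apply_eq_smul_iff f hk _).1 hf).2.2 j
  have key := mul_eq_of_recurrence_reverse (r := fun m => (signedSinh ε t m : ℂ)) h
    (by simp [legValues]) (fun m => by exact_mod_cast signedSinh_recurrence hε t m)
    (by simp [signedSinh_zero])
  have h1 := key m i hmi
  have h2 : f (Sum.inl none) * _ = _ := key (k j + 1) 0 (by omega)
  have h3 : (signedSinh ε t 1 : ℂ) ≠ 0 :=
    Complex.ofReal_ne_zero.2 (signedSinh_succ_ne_zero hε ht 0)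
  refine mul_right_cancel₀ h3 ?_
  simp only at h1 h2
  linear_combination (signedSinh ε t (k j + 1) : ℂ) * h1 - (signedSinh ε t m : ℂ) * h2

/-- As `sinh` vanishes only at 0, nothing on a leg or the tail survives a zero root value. Hence
eigenspaces have dimension at most one. -/
theorem eq_zero_of_root_eq_zero (h0 : f (Sum.inl none) = 0) : f = 0 := by
  ext ((_ | ⟨j, i⟩) | m)
  · exact h0
  · have h := legValues_of_eigenvector hk hε ht hf j (k j - i) (i + 1) (by omega)
    have h3 : (signedSinh ε t (k j + 1) : ℂ) ≠ 0 :=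
      Complex.ofReal_ne_zero.2 (signedSinh_succ_ne_zero hε ht _)
    rw [h0, zero_mul, mul_eq_zero, or_iff_left h3, legValues, dif_pos i.2] at h
    exact h
  · exact (tailValues_of_eigenvector hk hε ht hf).2 h0 (m + 1)

/-- Divide the root equation by the root value and by `ε`, then use `2 cosh t - exp (-t) = exp t`.
-/
theorem starEquation_of_eigenvector (h0 : f (Sum.inl none) ≠ 0) : StarEquation k t := by
  have hroot := ((multipleStarRayOperator_apply_eq_smul_iff f hk _).1 hf).2.1
  have hleg : ∀ j, legValues f j 1 =
      ((ε * (Real.sinh (k j * t) / Real.sinh ((k j + 1) * t)) : ℝ) : ℂ) * f (Sum.inl none) := by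
    intro j
    have h := legValues_of_eigenvector hk hε ht hf j (k j) 1 (by omega)
    have h3 : (signedSinh ε t (k j + 1) : ℂ) ≠ 0 :=
      Complex.ofReal_ne_zero.2 (signedSinh_succ_ne_zero hε ht _)
    rw [← signedSinh_div hε ht, Complex.ofReal_div, div_mul_eq_mul_div, eq_div_iff h3, h, mul_comm]
  rw [Finset.sum_congr rfl fun j _ => hleg j, ← Finset.sum_mul,
    (tailValues_of_eigenvector hk hε ht hf).1, ← add_mul] at hroot
  have h := mul_right_cancel₀ h0 hroot
  rw [← Complex.ofReal_sum, ← Complex.ofReal_add, Complex.ofReal_inj, ← Finset.mul_sum,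
    ← mul_add] at h
  have hε0 : ε ≠ 0 := by
    rintro rfl
    norm_num at hε
  have h' := mul_left_cancel₀ hε0 h
  rw [Real.cosh_eq] at h'
  rw [StarEquation]
  linarith

end Forward

/-- A positive solution of the star equation yields an eigenvector. -/
theorem exists_eigenvector (hk : ∀ j, 1 ≤ k j) {ε : ℝ} (hε : ε ^ 2 = 1) {t : ℝ} (ht : 0 < t)
    (hs : StarEquation k t) :
    ∃ f : lp (fun _ : Option (Σ j : Fin n, Fin (k j)) ⊕ ℕ => ℂ) 2, f ≠ 0 ∧
      multipleStarRayOperator k f = ((ε * (2 * Real.cosh t) : ℝ) : ℂ) • f := by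
  set x : ℝ := ε * Real.exp (-t) with hx
  have hx0 : x ≠ 0 := by
    refine mul_ne_zero ?_ (Real.exp_pos _).ne'
    rintro rfl
    norm_num at hε
  let r : ℕ → ℝ := signedSinh ε t
  have hr : ∀ m, r (m + 1) ≠ 0 := signedSinh_succ_ne_zero hε ht
  -- Normalised to 1 at the root. Vertex `i` of a leg has index `i + 1`, hence lies `k j - i` steps
  -- before the fictitious zero at `k j + 1`.
  let g : Option (Σ j : Fin n, Fin (k j)) ⊕ ℕ → ℂ := fun v =>
    match v with
    | Sum.inl none => 1
    | Sum.inl (some ⟨j, i⟩) => ((r (k j - i) / r (k j + 1) : ℝ) : ℂ)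
    | Sum.inr m => ((x ^ (m + 1) : ℝ) : ℂ)
  have hg : Memℓp g 2 := by
    refine memℓp_gen ?_
    refine Summable.sum _ (Summable.of_finite) ?_
    have h1 : |x ^ 2| < 1 := by
      rw [abs_pow]
      exact pow_lt_one₀ (abs_nonneg _) (norm_mul_exp_neg_lt_one hε ht) two_ne_zero
    refine ((summable_geometric_of_abs_lt_one h1).mul_left (x ^ 2)).congr fun m => ?_
    simp only [g, Function.comp_apply, Complex.norm_real, ENNReal.toReal_ofNat, Real.rpow_ofNat,
      Real.norm_eq_abs, sq_abs]
    ring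
  have htail : ∀ m, tailValues g m = ((x ^ m : ℝ) : ℂ) := by
    rintro (_ | m)
    · simp [tailValues, g]
    · rfl
  have hleg : ∀ j, ∀ i ≤ k j + 1, legValues g j i = ((r (k j + 1 - i) / r (k j + 1) : ℝ) : ℂ) := by
    intro j i hi
    cases i with
    | zero => simp [legValues, g, hr]
    | succ i =>
      by_cases h : i < k j
      · simp only [legValues, dif_pos h, g, Nat.add_sub_add_right]
      · have e : k j + 1 - (i + 1) = 0 := by omega
        rw [legValues, dif_neg h, e]
        simp [r, signedSinh_zero]
  refine ⟨⟨g, hg⟩, ?_, ?_⟩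
  · intro h
    have : g (Sum.inl none) = 0 := congrArg (fun f : lp _ 2 => f (Sum.inl none)) h
    simp [g] at this
  · rw [multipleStarRayOperator_apply_eq_smul_iff _ hk]
    refine ⟨fun m => ?_, ?_, fun j i hi => ?_⟩
    · change tailValues g m + tailValues g (m + 2) = _ * tailValues g (m + 1)
      rw [htail, htail, htail, energy_eq hε, ← hx]
      norm_cast
      field_simp
      ring
    · change tailValues g 1 + ∑ j, legValues g j 1 = _ * g (Sum.inl none)
      rw [htail, Finset.sum_congr rfl fun j _ => hleg j 1 (by omega)]
      simp only [Nat.add_sub_cancel, r, signedSinh_div hε ht, g]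
      rw [← Complex.ofReal_sum, ← Complex.ofReal_add, mul_one, Complex.ofReal_inj,
        ← Finset.mul_sum, show ∑ j, _ = _ from hs, Real.cosh_eq, hx]
      ring
    · change legValues g j i + legValues g j (i + 2) = _ * legValues g j (i + 1)
      rw [hleg j i (by omega), hleg j (i + 1) (by omega), hleg j (i + 2) (by omega)]
      obtain ⟨m, hm⟩ : ∃ m, k j = i + m + 1 := ⟨k j - i - 1, by omega⟩
      rw [show k j + 1 - i = m + 2 by omega, show k j + 1 - (i + 1) = m + 1 by omega,
        show k j + 1 - (i + 2) = m by omega]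
      have h := signedSinh_recurrence hε t m
      rw [← Complex.ofReal_add, ← Complex.ofReal_mul, ← add_div, ← mul_div_assoc, ← h, add_comm]

/-- Real numbers off the band, written as energies. -/
theorem exists_energy_of_notMem_band {a : ℝ} (ha : (a : ℂ) ∉ band) :
    ∃ ε t : ℝ, (ε = 1 ∨ ε = -1) ∧ 0 < t ∧ a = ε * (2 * Real.cosh t) := by
  have h : 2 < |a| := by
    by_contra! h
    exact ha ⟨a, abs_le.1 h, rfl⟩
  refine ⟨SignType.sign a, Real.arcosh (|a| / 2), ?_, Real.arcosh_pos (by linarith), ?_⟩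
  · rcases lt_trichotomy a 0 with h0 | rfl | h0
    · simp [h0]
    · norm_num at h
    · simp [h0]
  · rw [Real.cosh_arcosh (by linarith), mul_div_cancel₀ _ two_ne_zero, sign_mul_abs]

theorem energy_notMem_band {ε t : ℝ} (hε : ε = 1 ∨ ε = -1) (ht : 0 < t) :
    ((ε * (2 * Real.cosh t) : ℝ) : ℂ) ∉ band := by
  rintro ⟨a, ⟨h1, h2⟩, h⟩
  have h3 := Real.one_lt_cosh.2 ht.ne'
  have h4 := Complex.ofReal_injective h
  rcases hε with rfl | rfl <;> linarith

theorem hasEigenvalue_iff_starEquation (hk : ∀ j, 1 ≤ k j) {ε : ℝ} (hε : ε = 1 ∨ ε = -1) {t : ℝ}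
    (ht : 0 < t) :
    Module.End.HasEigenvalue (multipleStarRayOperator k).toLinearMap
      ((ε * (2 * Real.cosh t) : ℝ) : ℂ) ↔ StarEquation k t := by
  have hε2 : ε ^ 2 = 1 := by rcases hε with rfl | rfl <;> norm_num
  constructor
  · intro h
    obtain ⟨f, hf⟩ := h.exists_hasEigenvector
    have hf' : multipleStarRayOperator k f = _ • f := hf.apply_eq_smul
    exact starEquation_of_eigenvector hk hε2 ht hf' fun h0 =>
      hf.2 (eq_zero_of_root_eq_zero hk hε2 ht hf' h0)
  · intro hs
    obtain ⟨f, hf0, hf⟩ := exists_eigenvector hk hε2 ht hs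
    exact Module.End.hasEigenvalue_of_hasEigenvector
      ⟨Module.End.mem_eigenspace_iff.2 hf, hf0⟩

theorem finiteDimensional_eigenspace (hk : ∀ j, 1 ≤ k j) {ε : ℝ} (hε : ε = 1 ∨ ε = -1) {t : ℝ}
    (ht : 0 < t) :
    FiniteDimensional ℂ (Module.End.eigenspace (multipleStarRayOperator k).toLinearMap
      ((ε * (2 * Real.cosh t) : ℝ) : ℂ)) := by
  have hε2 : ε ^ 2 = 1 := by rcases hε with rfl | rfl <;> norm_num
  let φ : Module.End.eigenspace (multipleStarRayOperator k).toLinearMap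
      ((ε * (2 * Real.cosh t) : ℝ) : ℂ) →ₗ[ℂ] ℂ :=
    { toFun := fun f => f.1 (Sum.inl none)
      map_add' := fun a b => by simp
      map_smul' := fun c a => by simp }
  refine FiniteDimensional.of_injective φ ((injective_iff_map_eq_zero φ).2 fun f hf => ?_)
  exact Subtype.ext (eq_zero_of_root_eq_zero hk hε2 ht (Module.End.mem_eigenspace_iff.1 f.2) hf)

/-- The spectrum off the band is given by the positive solutions of the star equation. -/
theorem mem_spectrum_diff_band_iff (hk : ∀ j, 1 ≤ k j) (z : ℂ) :
    z ∈ spectrum ℂ (multipleStarRayOperator k) \ band ↔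
      ∃ ε t : ℝ, (ε = 1 ∨ ε = -1) ∧ 0 < t ∧ StarEquation k t ∧
        z = ((ε * (2 * Real.cosh t) : ℝ) : ℂ) := by
  constructor
  · rintro ⟨hz, hb⟩
    -- Reality of `z` turns being off the band into `2 < ‖z‖`, as the compactness argument requires.
    have hre := (isSelfAdjoint_adjacencyOperator _
      (uniformlyLocallyFinite_multipleStarRay k)).mem_spectrum_eq_re hz
    rw [hre] at hb
    obtain ⟨ε, t, hε, ht, h⟩ := exists_energy_of_notMem_band hb
    rw [h] at hre
    refine ⟨ε, t, hε, ht, ?_, hre⟩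
    rw [← hasEigenvalue_iff_starEquation hk hε ht, ← hre]
    refine hasEigenvalue_multipleStarRayOperator_of_mem_spectrum ?_ hz
    have h3 := Real.one_lt_cosh.2 ht.ne'
    rw [hre, Complex.norm_real, Real.norm_eq_abs, lt_abs]
    rcases hε with rfl | rfl
    · left
      linarith
    · right
      linarith
  · rintro ⟨ε, t, hε, ht, hs, rfl⟩
    exact ⟨mem_spectrum_of_hasEigenvalue ((hasEigenvalue_iff_starEquation hk hε ht).2 hs),
      energy_notMem_band hε ht⟩

theorem discreteSpectrum_multipleStarRayOperator (hk : ∀ j, 1 ≤ k j) :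
    discreteSpectrum (multipleStarRayOperator k)
      = spectrum ℂ (multipleStarRayOperator k) \ band := by
  ext z
  constructor
  · rintro ⟨hb, he, -⟩
    exact ⟨mem_spectrum_of_hasEigenvalue he, hb⟩
  · intro h
    obtain ⟨ε, t, hε, ht, hs, rfl⟩ := (mem_spectrum_diff_band_iff hk z).1 h
    exact ⟨energy_notMem_band hε ht, (hasEigenvalue_iff_starEquation hk hε ht).2 hs,
      finiteDimensional_eigenspace hk hε ht⟩

end Eigen

end TailedGraph

end

/-! ### The main theorem -/

theorem mainTheorem2 (n : ℕ) (hn : 2 ≤ n) (k : Fin n → ℕ) (hk : ∀ j, 1 ≤ k j)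
    (hne : ¬ (n = 2 ∧ ∀ j, k j = 1)) :
    (∃ tp : ℝ,
      (0 < tp ∧ TailedGraph.StarEquation k tp ∧
        ∀ t : ℝ, 0 < t → TailedGraph.StarEquation k t → t = tp) ∧
      TailedGraph.discreteSpectrum (TailedGraph.multipleStarRayOperator k) =
        {((2 * Real.cosh tp : ℝ) : ℂ), ((-(2 * Real.cosh tp) : ℝ) : ℂ)} ∧
      spectrum ℂ (TailedGraph.multipleStarRayOperator k) \ TailedGraph.band =
        {((2 * Real.cosh tp : ℝ) : ℂ), ((-(2 * Real.cosh tp) : ℝ) : ℂ)}) ∧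
    ∀ p : ℕ, (∀ j, k j = p) → ∀ t : ℝ, 0 < t →
      (TailedGraph.StarEquation k t ↔
        ((n : ℝ) - 1) * Real.exp (-t) ^ (2 * p + 2) - (n : ℝ) * Real.exp (-t) ^ 2 + 1 = 0) := by
  obtain ⟨tp, htp, hs, huniq⟩ := TailedGraph.exists_unique_starEquation hn hk hne
  have hspec : spectrum ℂ (TailedGraph.multipleStarRayOperator k) \ TailedGraph.band =
      {((2 * Real.cosh tp : ℝ) : ℂ), ((-(2 * Real.cosh tp) : ℝ) : ℂ)} := by
    ext z
    rw [TailedGraph.mem_spectrum_diff_band_iff hk, Set.mem_insert_iff, Set.mem_singleton_iff]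
    constructor
    · rintro ⟨ε, t, hε, ht, h, rfl⟩
      obtain rfl := huniq t ht h
      rcases hε with rfl | rfl
      · left
        rw [one_mul]
      · right
        rw [neg_one_mul]
    · rintro (rfl | rfl)
      · exact ⟨1, tp, Or.inl rfl, htp, hs, by rw [one_mul]⟩
      · exact ⟨-1, tp, Or.inr rfl, htp, hs, by rw [neg_one_mul]⟩
  refine ⟨⟨tp, ⟨htp, hs, huniq⟩, ?_, hspec⟩,
    fun p hp t ht => TailedGraph.starEquation_iff_of_eq hp ht⟩
  rw [TailedGraph.discreteSpectrum_multipleStarRayOperator hk, hspec]
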